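/- \textbf{Setting.} Consider a sequential team with decision makers $i=1,\dots,N$ acting in this order. The exogenous variables $\omega_0,\omega_1,\dots,\omega_N$ take values in measurable spaces and are independent, with laws $P_0,P_1,\dots,P_N$. Decision maker $i$ observes $$y^i=\eta^i(\omega_0,y^1,\dots,y^{i-1},u^1,\dots,u^{i-1},\omega_i)\in\mathbb Y^i ,$$ with $\eta^i$ measurable, and applies $u^i=\gamma^i(y^i)\in\mathbb U^i$, where $\gamma^i:\mathbb Y^i\to\mathbb U^i$ is measurable. The spaces $\mathbb Y^i$ are standard Borel, and the $\mathbb U^i$ are nonempty Borel subsets of Polish spaces. (The team is static if no $\eta^i$ depends on the actions.) Let $\Gamma$ be the set of all policies $\underline\gamma=(\gamma^1,\dots,\gamma^N)$, let $c(\omega_0,\mathbf y,\mathbf u)\in[0,\infty)$ be a measurable cost, where $\mathbf y=(y^1,\dots,y^N)$ and $\mathbf u=(u^1,\dots,u^N)$, and let $J(\underline\gamma)=E^{\underline\gamma}[c(\omega_0,\mathbf y,\mathbf u)]\in[0,\infty]$. Suppose that the team (static or dynamic) admits an independent static reduction: there are probability measures $Q^i$ on $\mathbb Y^i$ and measurable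 functions $f_i\ge 0$ such that for $P_0$-almost every $\omega_0$, all $i$, all $y^1,\dots,y^{i-1},u^1,\dots,u^{i-1}$ and all measurable $S\subset\mathbb Y^i$, $$P_i\big(\{\omega_i:\ \eta^i(\omega_0,y^1,\dots,y^{i-1},u^1,\dots,u^{i-1},\omega_i)\in S\}\big)=\int_S f_i(y^i,\omega_0,y^1,\dots,y^{i-1},u^1,\dots,u^{i-1})\,Q^i(dy^i).$$ The cost of the reduced team, in which $\omega_0,y^1,\dots,y^N$ are independent with laws $P_0,Q^1,\dots,Q^N$, is $$c_s(\omega_0,\mathbf y,\mathbf u)=c(\omega_0,\mathbf y,\mathbf u)\prod_{i=1}^N f_i(y^i,\omega_0,y^1,\dots,y^{i-1},u^1,\dots,u^{i-1}).$$ \textbf{Theorem.} Assume that (1) for all $\omega_0,\mathbf y$, the function $\mathbf u\mapsto c_s(\omega_0,\mathbf y,\mathbf u)$ is lower semicontinuous on $\prod_i\mathbb U^i$ (for a static team this holds whenever $c$ is lower semicontinuous in $\mathbf u$, as then the $f_i$ do not depend on $\mathbf u$); (2) each $\mathbb U^i=\bigcup_n K^i_n$ with $K^i_1\subset K^i_2\subset\cdots$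 compact; (3) there are $M<\infty$ and lower semicontinuous $\phi^i:\mathbb U^i\to[0,\infty)$ with $\lim_{n\to\infty}\inf_{u\notin K^i_n}\phi^i(u)=\infty$ (with $\inf\emptyset=\infty$) such that the control laws can be restricted, without loss, to those satisfying the moment bounds $E[\phi^i(u^i)]\le M$ in the reduced team, that is, $$\inf\Big\{J(\underline\gamma):\ \underline\gamma\in\Gamma,\ \int\phi^i(\gamma^i(y^i))\,Q^i(dy^i)\le M\ \text{ for all } i\Big\}=\inf_{\underline\gamma\in\Gamma}J(\underline\gamma).$$ Then an optimal team policy exists and can be taken deterministic: there is $\underline\gamma^*\in\Gamma$ with $J(\underline\gamma^*)=\inf_{\underline\gamma\in\Gamma}J(\underline\gamma)$. Moreover, $J(\underline\gamma^*)$ is at most the expected cost of every individually randomized policy, that is, every policy under which each $u^i$ is drawn from $\Pi^i(\cdot\,|\,y^i)$ for some stochastic kernels $\Pi^i$ from $\mathbb Y^i$ to $\mathbb U^i$. -/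

import Mathlib

open MeasureTheory ProbabilityTheory Filter Topology
open scoped ENNReal NNReal

/-- The coordinates `x^1, …, x^{i-1}` preceding coordinate `i`. -/
abbrev Past {N : ℕ} (X : Fin N → Type*) (i : Fin N) : Type _ :=
  ∀ k : {k : Fin N // k < i}, X k

/-- The restriction of a full profile `x^1, …, x^N` to the coordinates preceding `i`. -/
def Past.of {N : ℕ} {X : Fin N → Type*} (i : Fin N) (x : ∀ k, X k) : Past X i :=
  fun k => x k

/-- What has been realized before decision maker `i` measures: `ω₀`, the earlier measurements
and the earlier actions. -/
abbrev Past.Hist {N : ℕ} (Ω₀ : Type*) (Y U : Fin N → Type*) (i : Fin N) : Type _ :=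
  Ω₀ × Past Y i × Past U i

/-- A sequential stochastic team with decision makers `0, …, N - 1` acting in this order.
The exogenous variables `ω₀, ω_1, …, ω_N` are independent with laws `P₀, P_1, …, P_N`; decision
maker `i` measures `y^i = η^i(ω₀, y^1, …, y^{i-1}, u^1, …, u^{i-1}, ω_i)`; the cost is
`c(ω₀, y, u)`. The team is static when no `η^i` depends on the actions. -/
structure SequentialTeam (N : ℕ) (Ω₀ : Type*) (Ω Y U : Fin N → Type*)
    [MeasurableSpace Ω₀] [∀ i, MeasurableSpace (Ω i)] [∀ i, MeasurableSpace (Y i)]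
    [∀ i, MeasurableSpace (U i)] where
  /-- law of `ω₀` -/
  P₀ : Measure Ω₀
  isProb₀ : IsProbabilityMeasure P₀
  /-- law of the measurement noise `ω_i` -/
  P : ∀ i, Measure (Ω i)
  isProb : ∀ i, IsProbabilityMeasure (P i)
  /-- measurement functions -/
  η : ∀ i, Past.Hist Ω₀ Y U i × Ω i → Y i
  measurable_η : ∀ i, Measurable (η i)
  /-- cost function -/
  c : Ω₀ × (∀ i, Y i) × (∀ i, U i) → ℝ≥0
  measurable_c : Measurable c

namespace SequentialTeam

attribute [instance] SequentialTeam.isProb₀ SequentialTeam.isProb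

variable {N : ℕ} {Ω₀ : Type*} {Ω Y U : Fin N → Type*}
  [MeasurableSpace Ω₀] [∀ i, MeasurableSpace (Ω i)] [∀ i, MeasurableSpace (Y i)]
  [∀ i, MeasurableSpace (U i)]

/-- Admissible (deterministic) team policies: measurable control laws `u^i = γ^i(y^i)`. -/
abbrev Policy (_T : SequentialTeam N Ω₀ Ω Y U) : Type _ :=
  ∀ i, {g : Y i → U i // Measurable g}

/-- The measurements and actions `(y^i, u^i)` that policy `γ` produces when the exogenous
variables are `ω₀, ω`. -/
def outcome (T : SequentialTeam N Ω₀ Ω Y U) (γ : T.Policy) (ω₀ : Ω₀) (ω : ∀ i, Ω i)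
    (i : Fin N) : Y i × U i :=
  let y : Y i := T.η i
    ((ω₀, (fun k => (outcome T γ ω₀ ω k.1).1), (fun k => (outcome T γ ω₀ ω k.1).2)), ω i)
  (y, (γ i).1 y)
termination_by i.val
decreasing_by all_goals exact k.2

/-- The expected cost `J(γ) = E[c(ω₀, y, u)]` of a policy. -/
noncomputable def J (T : SequentialTeam N Ω₀ Ω Y U) (γ : T.Policy) : ℝ≥0∞ :=
  ∫⁻ ω, (T.c (ω.1, (fun i => (T.outcome γ ω.1 ω.2 i).1), (fun i => (T.outcome γ ω.1 ω.2 i).2)) :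
    ℝ≥0∞) ∂(T.P₀.prod (Measure.pi T.P))

/-- Team-optimal policies. -/
def IsOptimal (T : SequentialTeam N Ω₀ Ω Y U) (γ : T.Policy) : Prop :=
  T.J γ = ⨅ γ' : T.Policy, T.J γ'

/-- The measurement channel of decision maker `i`: the law of `y^i` given
`(ω₀, y^1, …, y^{i-1}, u^1, …, u^{i-1})`. -/
noncomputable def channel (T : SequentialTeam N Ω₀ Ω Y U) (i : Fin N) :
    Kernel (Past.Hist Ω₀ Y U i) (Y i) :=
  (Kernel.id ×ₖ Kernel.const _ (T.P i)).map (T.η i)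

/-- `μ` is the strategic measure of the individually randomized policy `κ`, that is, the law of
`(ω₀, y, u)` when each `u^i` is drawn from `κ^i(du^i | y^i)`: the law of `ω₀` is `P₀`, the
conditional law of `y^i` given the past is the measurement channel, and the conditional law of
`u^i` given the past and `y^i` is `κ^i(· | y^i)`. -/
structure IsStrategicMeasure (T : SequentialTeam N Ω₀ Ω Y U) (κ : ∀ i, Kernel (Y i) (U i))
    (μ : Measure (Ω₀ × (∀ i, Y i) × (∀ i, U i))) : Prop where
  law_state : μ.map (fun s => s.1) = T.P₀
  law_measurement : ∀ i,
    μ.map (fun s => ((s.1, Past.of i s.2.1, Past.of i s.2.2), s.2.1 i)) =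
      (μ.map (fun s => (s.1, Past.of i s.2.1, Past.of i s.2.2))) ⊗ₘ T.channel i
  law_action : ∀ i,
    μ.map (fun s => (((s.1, Past.of i s.2.1, Past.of i s.2.2), s.2.1 i), s.2.2 i)) =
      (μ.map (fun s => ((s.1, Past.of i s.2.1, Past.of i s.2.2), s.2.1 i))) ⊗ₘ
        Kernel.prodMkLeft (Past.Hist Ω₀ Y U i) (κ i)

/-- An independent static reduction: reference probability measures `Q^i` on the measurement
spaces and measurable densities `f_i` of the measurement channels with respect to them. -/
structure IndependentReduction (T : SequentialTeam N Ω₀ Ω Y U) where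
  /-- reference measures -/
  Q : ∀ i, Measure (Y i)
  isProb : ∀ i, IsProbabilityMeasure (Q i)
  /-- densities -/
  f : ∀ i, Past.Hist Ω₀ Y U i × Y i → ℝ≥0
  measurable_f : ∀ i, Measurable (f i)
  channel_eq : ∀ i, ∀ᵐ ω₀ ∂T.P₀, ∀ (y : Past Y i) (u : Past U i),
    T.channel i (ω₀, y, u) = (Q i).withDensity (fun z => (f i ((ω₀, y, u), z) : ℝ≥0∞))

attribute [instance] IndependentReduction.isProb

/-- The cost of the reduced team,
`c_s(ω₀, y, u) = c(ω₀, y, u) ∏ i, f_i(y^i, ω₀, y^1, …, y^{i-1}, u^1, …, u^{i-1})`. -/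
def IndependentReduction.cost {T : SequentialTeam N Ω₀ Ω Y U} (R : T.IndependentReduction)
    (ω₀ : Ω₀) (y : ∀ i, Y i) (u : ∀ i, U i) : ℝ≥0 :=
  T.c (ω₀, y, u) * ∏ i, R.f i ((ω₀, Past.of i y, Past.of i u), y i)

end SequentialTeam

/-!
The expected cost of a policy can be computed in the reduced team. Integrating out the decision
makers one at a time, and replacing each measurement channel by its density, shows that the
expected cost is the integral of the mean reduced cost `C(y, u) = ∫ c_s(ω₀, y, u) P₀(dω₀)` over
independent pairs `(y^i, u^i)` whose laws `ρ^i` have first marginal `Q^i`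
(`IsStrategicMeasure.lintegral_cost`, `J_eq_lintegral_meanCost`). This holds for deterministic
policies, where `ρ^i` is carried by the graph of `γ^i`, and for individually randomized ones, where
`ρ^i = Q^i ⊗ Π^i`.

For some Polish topology on the measurement spaces, the moment bounds make the laws `ρ^i` of the
admissible deterministic policies tight, so by Prokhorov's theorem they lie in a compact set of
laws with first marginal `Q^i` (`isCompact_closure_boundedGraphLaws`). On laws with these marginals
the expected cost is lower semicontinuous in `(ρ^1, …, ρ^N)`
(`lowerSemicontinuousOn_lintegral_pi`). Weak convergence alone controls only costs that are lower
semicontinuous in `(y, u)` jointly, whereas `C` is merely measurable in `y`. But a superlevel set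
of `C` has open sections in `u`; it is a countable union of products of a coanalytic set of `y`'s
with an open set of `u`'s, and universal measurability of analytic sets together with outer
regularity lets it be enlarged to an open set at the expense of a set of `y`'s of small measure
(`exists_isOpen_superset_of_isOpen_sections`). That measure is the same for all laws considered,
as the marginals are fixed.

Hence the minimum over the compact set is attained, at some independently randomized `(ρ^i)`. Its
kernels can be written as deterministic control laws that depend on independent uniform
variables; averaging over these variables shows that some deterministic policy does at least as
well (`exists_lintegral_pi_graphLaw_le`). The same averaging bounds the cost of every individually
randomized policy from below by the optimal deterministic cost.
-/

/-! ### Universal measurability of analytic sets -/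

theorem isCompact_setOf_forall_le (a : ℕ → ℕ) : IsCompact {x : ℕ → ℕ | ∀ i, x i ≤ a i} := by
  have : {x : ℕ → ℕ | ∀ i, x i ≤ a i} = Set.univ.pi fun i => Set.Iic (a i) := by
    ext x
    simp only [Set.mem_univ_pi, Set.mem_Iic, Set.mem_ofPred_eq]
  rw [this]
  exact isCompact_univ_pi fun i => (Set.finite_Iic (a i)).isCompact

/-- Compact boxes `∏ i, [0, a i]` in Baire space are well approximated by the cylinders
`{x | ∀ i < n, x i ≤ a i}`, although these are not compact. -/
theorem exists_forall_lt_le_subset_of_isOpen {a : ℕ → ℕ} {W : Set (ℕ → ℕ)} (hW : IsOpen W)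
    (ha : {x : ℕ → ℕ | ∀ i, x i ≤ a i} ⊆ W) :
    ∃ n, {x : ℕ → ℕ | ∀ i < n, x i ≤ a i} ⊆ W := by
  by_contra! h
  simp only [Set.not_subset] at h
  choose y hy hyW using h
  -- Truncating `y n` after `n` coordinates gives points of the box with the same limit points.
  obtain ⟨x, hx, ψ, hψ, hlim⟩ := (isCompact_setOf_forall_le a).tendsto_subseq
    (x := fun n i => if i < n then y n i else 0) (fun n i => by
      by_cases hi : i < n <;> simp [hi, hy n i])
  have hlim' : Tendsto (y ∘ ψ) atTop (𝓝 x) := by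
    rw [tendsto_pi_nhds] at hlim ⊢
    intro i
    refine (hlim i).congr' ?_
    filter_upwards [eventually_gt_atTop i] with n hn
    simp [hn.trans_le (hψ.le_apply)]
  exact hW.isClosed_compl.mem_of_tendsto hlim' (Eventually.of_forall fun n => hyW _) (ha hx)

/-- Inner approximation of an analytic set by compact sets (Choquet's capacitability theorem for
a finite Borel measure). -/
theorem MeasureTheory.AnalyticSet.exists_isCompact_le_measure {α : Type*} [TopologicalSpace α]
    [MeasurableSpace α] {μ : Measure α} [μ.OuterRegular] {s : Set α}
    (hs : AnalyticSet s) {c : ℝ≥0∞} (hc : c < μ s) :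
    ∃ K ⊆ s, IsCompact K ∧ c ≤ μ K := by
  rw [AnalyticSet] at hs
  rcases hs with rfl | ⟨f, hf, rfl⟩
  · simp at hc
  -- Bound the coordinates one after another, keeping the outer measure of the image above `c`.
  have step : ∀ (n : ℕ) (S : Set (ℕ → ℕ)), c < μ (f '' S) →
      ∃ k, c < μ (f '' (S ∩ {x | x n ≤ k})) := by
    intro n S hS
    have hmono : Monotone fun k => f '' (S ∩ {x | x n ≤ k}) := fun k l hkl =>
      Set.image_mono (Set.inter_subset_inter_right _ fun x (hx : x n ≤ k) => hx.trans hkl)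
    have hU : f '' S = ⋃ k, f '' (S ∩ {x | x n ≤ k}) := by
      rw [← Set.image_iUnion, ← Set.inter_iUnion]
      congr 1
      refine (Set.inter_eq_left.2 fun x _ => ?_).symm
      exact Set.mem_iUnion.2 ⟨x n, le_refl (x n)⟩
    rw [hU, hmono.measure_iUnion, lt_iSup_iff] at hS
    exact hS
  choose! b hb using step
  let S : ℕ → Set (ℕ → ℕ) := fun n =>
    Nat.rec Set.univ (fun n S => S ∩ {x | x n ≤ b n S}) n
  let a : ℕ → ℕ := fun n => b n (S n)
  have hS : ∀ n, c < μ (f '' S n) := by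
    intro n
    induction n with
    | zero => simpa [S] using hc
    | succ n ih => exact hb n _ ih
  have hSa : ∀ n, S n = {x | ∀ i < n, x i ≤ a i} := by
    intro n
    induction n with
    | zero => simp [S]
    | succ n ih =>
      have : S (n + 1) = S n ∩ {x | x n ≤ a n} := rfl
      rw [this, ih]
      ext x
      simp only [Set.mem_inter_iff, Set.mem_ofPred_eq, Nat.lt_succ_iff_lt_or_eq]
      grind
  refine ⟨f '' {x | ∀ i, x i ≤ a i}, Set.image_subset_range _ _,
    (isCompact_setOf_forall_le a).image hf, ?_⟩
  rw [Set.measure_eq_iInf_isOpen]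
  refine le_iInf₂ fun V hV => le_iInf fun hVo => ?_
  obtain ⟨n, hn⟩ := exists_forall_lt_le_subset_of_isOpen (hVo.preimage hf)
    (Set.image_subset_iff.1 hV)
  exact (hS n).le.trans (measure_mono (Set.image_subset_iff.2 (hSa n ▸ hn)))

/-- Analytic sets are universally measurable. -/
theorem MeasureTheory.AnalyticSet.nullMeasurableSet {α : Type*} [TopologicalSpace α] [T2Space α]
    [MeasurableSpace α] [OpensMeasurableSpace α] {μ : Measure α} [IsFiniteMeasure μ]
    [μ.OuterRegular] {s : Set α} (hs : AnalyticSet s) : NullMeasurableSet s μ := by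
  rcases eq_or_ne (μ s) 0 with h0 | h0
  · exact NullMeasurableSet.of_null h0
  obtain ⟨u, -, hu, hlim⟩ := exists_seq_strictMono_tendsto' (pos_iff_ne_zero.2 h0)
  choose K hKs hKc hK using fun n => hs.exists_isCompact_le_measure (hu n).2
  have hm : MeasurableSet (⋃ n, K n) := .iUnion fun n => (hKc n).measurableSet
  have hle : μ s ≤ μ (⋃ n, K n) := le_of_tendsto' hlim fun n =>
    (hK n).trans (measure_mono (Set.subset_iUnion _ _))
  exact hm.nullMeasurableSet.congr
    (ae_eq_of_subset_of_measure_ge (Set.iUnion_subset hKs) hle hm.nullMeasurableSet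
      (measure_ne_top _ _))

/-! ### Measurable functions that are lower semicontinuous in one variable -/

/-- A measurable set `A ⊆ Y × U` with open sections `A_y` is contained in an open set that exceeds
it only over a set of points `y` of small measure. The reason: if `B_j` is a countable base of `U`,
then `A = ⋃ j, {y | B_j ⊆ A_y} × B_j`, where the sets of points `y` are coanalytic, hence
universally measurable and outer regular. -/
theorem exists_isOpen_superset_of_isOpen_sections {Y U : Type*}
    [TopologicalSpace Y] [T2Space Y] [SecondCountableTopology Y] [MeasurableSpace Y] [BorelSpace Y]
    [StandardBorelSpace Y] [TopologicalSpace U] [SecondCountableTopology U] [MeasurableSpace U]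
    [OpensMeasurableSpace U] [StandardBorelSpace U]
    (m : Measure Y) [IsFiniteMeasure m] [m.OuterRegular] {A : Set (Y × U)} (hA : MeasurableSet A)
    (hAo : ∀ y, IsOpen {u | (y, u) ∈ A}) {ε : ℝ≥0∞} (hε : ε ≠ 0) :
    ∃ (G : Set (Y × U)) (W : Set Y), IsOpen G ∧ A ⊆ G ∧ G ⊆ A ∪ W ×ˢ Set.univ ∧ m W ≤ ε := by
  have hB := TopologicalSpace.isBasis_countableBasis U
  set B := TopologicalSpace.countableBasis U with hBdef
  have : Countable B := TopologicalSpace.countable_countableBasis U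
  let D : B → Set Y := fun b => (Prod.fst '' (Aᶜ ∩ Set.univ ×ˢ b.1))ᶜ
  have hD : ∀ b, NullMeasurableSet (D b) m := fun b =>
    (AnalyticSet.nullMeasurableSet <| (hA.compl.inter
      (MeasurableSet.univ.prod (hB.isOpen b.2).measurableSet)).analyticSet_image
        measurable_fst).compl
  have hDA : ∀ b y, y ∈ D b ↔ ∀ u ∈ b.1, (y, u) ∈ A := by
    intro b y
    simp only [D, Set.mem_compl_iff, Set.mem_image, Set.mem_inter_iff, Set.mem_prod, Set.mem_univ,
      true_and, Prod.exists, exists_and_right, exists_eq_right, not_exists, not_and]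
    grind
  obtain ⟨δ, hδ, hδs⟩ := ENNReal.exists_pos_sum_of_countable' hε B
  choose O hDO hO hOm using fun b => (D b).exists_isOpen_lt_add (measure_ne_top m _) (hδ b).ne'
  refine ⟨⋃ b, O b ×ˢ b.1, ⋃ b, O b \ D b, ?_, ?_, ?_, ?_⟩
  · exact isOpen_iUnion fun b => (hO b).prod (hB.isOpen b.2)
  · rintro ⟨y, u⟩ hyu
    obtain ⟨b, hb, hub, hbA⟩ := hB.exists_subset_of_mem_open hyu (hAo y)
    exact Set.mem_iUnion.2 ⟨⟨b, hb⟩, hDO _ ((hDA ⟨b, hb⟩ y).2 fun v hv => hbA hv), hub⟩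
  · rintro ⟨y, u⟩ hyu
    obtain ⟨b, hyb, hub⟩ := Set.mem_iUnion.1 hyu
    by_cases hy : y ∈ D b
    · exact .inl ((hDA b y).1 hy u hub)
    · exact .inr ⟨Set.mem_iUnion.2 ⟨b, hyb, hy⟩, trivial⟩
  · refine (measure_iUnion_le _).trans ((ENNReal.tsum_le_tsum fun b => ?_).trans hδs.le)
    exact (measure_sdiff_lt_of_lt_add (hD b) (hDO b) (measure_ne_top m _) (hOm b)).le

/-- If, uniformly on a set `S` of probability measures, the superlevel sets of `C` can be
approximated from outside by open sets, then `ν ↦ ∫ C dν` is lower semicontinuous on `S`. -/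
theorem lowerSemicontinuousOn_lintegral_of_forall_exists_isOpen {X : Type*} [TopologicalSpace X]
    [TopologicalSpace.PseudoMetrizableSpace X] [SecondCountableTopology X] [MeasurableSpace X]
    [OpensMeasurableSpace X] {S : Set (ProbabilityMeasure X)} {C : X → ℝ≥0∞} (hC : Measurable C)
    (h : ∀ (r ε : ℝ≥0∞), ε ≠ 0 → ∃ G, IsOpen G ∧ {x | r < C x} ⊆ G ∧
      ∀ ν ∈ S, (ν : Measure X) G ≤ (ν : Measure X) {x | r < C x} + ε) :
    LowerSemicontinuousOn (fun ν : ProbabilityMeasure X => ∫⁻ x, C x ∂(ν : Measure X)) S := by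
  have hset : ∀ r, ∀ ν₀ ∈ S, (ν₀ : Measure X) {x | r < C x} ≤
      liminf (fun ν : ProbabilityMeasure X => (ν : Measure X) {x | r < C x}) (𝓝[S] ν₀) := by
    intro r ν₀ hν₀
    have hne : (𝓝[S] ν₀).NeBot := mem_closure_iff_nhdsWithin_neBot.1 (subset_closure hν₀)
    refine ENNReal.le_of_forall_pos_le_add fun ε hε _ => ?_
    obtain ⟨G, hG, hsub, hle⟩ := h r ε (by simpa using hε.ne')
    calc (ν₀ : Measure X) {x | r < C x} ≤ (ν₀ : Measure X) G := measure_mono hsub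
      _ ≤ liminf (fun ν : ProbabilityMeasure X => (ν : Measure X) G) (𝓝[S] ν₀) :=
        ProbabilityMeasure.le_liminf_measure_open_of_tendsto
          (tendsto_id.mono_left nhdsWithin_le_nhds) hG
      _ ≤ liminf (fun ν : ProbabilityMeasure X => (ν : Measure X) {x | r < C x} + ε)
          (𝓝[S] ν₀) := liminf_le_liminf (eventually_mem_nhdsWithin.mono hle)
      _ = _ := liminf_add_const _ _ _ (by isBoundedDefault) (by isBoundedDefault)
  -- The layer cake formula and Fatou's lemma pass from superlevel sets to bounded functions.
  have htrunc : ∀ n : ℕ, LowerSemicontinuousOn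
      (fun ν : ProbabilityMeasure X => ∫⁻ x, min (C x) n ∂(ν : Measure X)) S := by
    intro n
    have hm : Measurable fun x => min (C x) n := hC.min measurable_const
    have hreal : ∀ x, min (C x) n = ENNReal.ofReal (min (C x) n).toReal := fun x =>
      (ENNReal.ofReal_toReal
        (ne_top_of_le_ne_top (ENNReal.natCast_ne_top n) (min_le_right _ _))).symm
    have hcake : ∀ ν : ProbabilityMeasure X, ∫⁻ x, min (C x) n ∂(ν : Measure X) =
        ∫⁻ t in Set.Ioi (0 : ℝ), (ν : Measure X) {x | t < (min (C x) n).toReal} := by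
      intro ν
      rw [lintegral_congr hreal]
      exact lintegral_eq_lintegral_meas_lt _ (Eventually.of_forall fun x => ENNReal.toReal_nonneg)
        hm.ennreal_toReal.aemeasurable
    simp_rw [hcake]
    refine lowerSemicontinuousOn_iff_le_liminf.2 fun ν₀ hν₀ => ?_
    refine (lintegral_mono_ae ?_).trans (lintegral_liminf_le fun ν => Antitone.measurable
      fun s t hst => measure_mono fun x (hx : t < _) => hst.trans_lt hx)
    refine (ae_restrict_mem measurableSet_Ioi).mono fun t (ht : 0 < t) => ?_
    have hlev : {x | t < (min (C x) n).toReal} =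
        if t < n then {x | ENNReal.ofReal t < C x} else ∅ := by
      ext x
      have hfin : min (C x) n ≠ ⊤ :=
        ne_top_of_le_ne_top (ENNReal.natCast_ne_top n) (min_le_right _ _)
      have : ENNReal.ofReal t < n ↔ t < n := by
        rw [← ENNReal.ofReal_natCast, ENNReal.ofReal_lt_ofReal_iff_of_nonneg ht.le]
      rw [Set.mem_ofPred_eq, ← ENNReal.ofReal_lt_iff_lt_toReal ht.le hfin, lt_min_iff, this]
      split_ifs with htn <;> simp [htn]
    simp only [hlev]
    split_ifs with htn
    · exact hset _ ν₀ hν₀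
    · simp
  have hsup : ∀ ν : ProbabilityMeasure X, ∫⁻ x, C x ∂(ν : Measure X) =
      ⨆ n : ℕ, ∫⁻ x, min (C x) n ∂(ν : Measure X) := by
    intro ν
    rw [← lintegral_iSup (fun n => hC.min measurable_const)
      fun a b hab x => min_le_min_left _ (by exact_mod_cast hab)]
    refine lintegral_congr fun x => ?_
    rw [← inf_iSup_eq, ENNReal.iSup_natCast, inf_top_eq]
  simp_rw [hsup]
  exact lowerSemicontinuousOn_iSup htrunc

/-- Lower semicontinuity of the expected cost of independently randomized decisions, in the joint
laws `ρ i` of observations and actions. The cost is only measurable in the observations, which is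
enough since their laws `Q i` are held fixed. -/
theorem lowerSemicontinuousOn_lintegral_pi {ι : Type*} [Fintype ι] {Y U : ι → Type*}
    [∀ i, TopologicalSpace (Y i)] [∀ i, PolishSpace (Y i)] [∀ i, MeasurableSpace (Y i)]
    [∀ i, BorelSpace (Y i)] [∀ i, TopologicalSpace (U i)]
    [∀ i, TopologicalSpace.MetrizableSpace (U i)] [∀ i, SecondCountableTopology (U i)]
    [∀ i, MeasurableSpace (U i)] [∀ i, BorelSpace (U i)] [∀ i, StandardBorelSpace (U i)]
    (Q : ∀ i, Measure (Y i)) [∀ i, IsProbabilityMeasure (Q i)]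
    {C : (∀ i, Y i × U i) → ℝ≥0∞} (hC : Measurable C)
    (hlsc : ∀ y : ∀ i, Y i, LowerSemicontinuous fun u : ∀ i, U i => C fun i => (y i, u i)) :
    LowerSemicontinuousOn (fun ρ : ∀ i, ProbabilityMeasure (Y i × U i) =>
      ∫⁻ z, C z ∂Measure.pi (fun i => (ρ i : Measure (Y i × U i))))
      {ρ | ∀ i, (ρ i : Measure (Y i × U i)).fst = Q i} := by
  let e : (∀ i, Y i × U i) → (∀ i, Y i) × (∀ i, U i) := fun z =>
    (fun i => (z i).1, fun i => (z i).2)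
  have he : Continuous e := by fun_prop
  have hfst : Measurable fun (z : ∀ i, Y i × U i) i => (z i).1 := by fun_prop
  let S : Set (ProbabilityMeasure (∀ i, Y i × U i)) :=
    {ν | (ν : Measure (∀ i, Y i × U i)).map (fun z i => (z i).1) = Measure.pi Q}
  -- Independence plays no role in the semicontinuity: only the law of all observations is fixed.
  have hF : LowerSemicontinuousOn
      (fun ν : ProbabilityMeasure (∀ i, Y i × U i) => ∫⁻ z, C z ∂(ν : Measure _)) S := by
    refine lowerSemicontinuousOn_lintegral_of_forall_exists_isOpen hC fun r ε hε => ?_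
    let A : Set ((∀ i, Y i) × (∀ i, U i)) := {p | r < C fun i => (p.1 i, p.2 i)}
    have hA : MeasurableSet A := measurableSet_lt measurable_const (hC.comp (by fun_prop))
    obtain ⟨G, W, hG, hAG, hGA, hW⟩ := exists_isOpen_superset_of_isOpen_sections (Measure.pi Q) hA
      (fun y => (hlsc y).isOpen_preimage r) (ε := ε) (by simpa using hε)
    refine ⟨e ⁻¹' G, hG.preimage he, fun z hz => hAG hz, fun ν hν => ?_⟩
    calc (ν : Measure (∀ i, Y i × U i)) (e ⁻¹' G)
        ≤ (ν : Measure _) ({z | r < C z} ∪ (fun (z : ∀ i, Y i × U i) i => (z i).1) ⁻¹' W) := by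
          refine measure_mono fun z hz => ?_
          rcases hGA hz with h | h
          · exact .inl h
          · exact .inr h.1
      _ ≤ (ν : Measure _) {z | r < C z} +
            (ν : Measure _) ((fun (z : ∀ i, Y i × U i) i => (z i).1) ⁻¹' W) :=
          measure_union_le _ _
      _ ≤ (ν : Measure _) {z | r < C z} + ε := by
          gcongr
          refine (Measure.le_map_apply hfst.aemeasurable W).trans ?_
          rw [hν]
          exact hW
  have hcont : Continuous fun ρ : ∀ i, ProbabilityMeasure (Y i × U i) => ProbabilityMeasure.pi ρ :=
    ProbabilityMeasure.continuous_pi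
  intro ρ hρ t ht
  have hmaps : Set.MapsTo (fun ρ : ∀ i, ProbabilityMeasure (Y i × U i) => ProbabilityMeasure.pi ρ)
      {ρ | ∀ i, (ρ i : Measure (Y i × U i)).fst = Q i} S := by
    intro ρ hρ
    change (Measure.pi fun i => (ρ i : Measure (Y i × U i))).map (fun z i => (z i).1) = Measure.pi Q
    rw [Measure.pi_map_pi fun i => measurable_fst.aemeasurable]
    congr 1
    funext i
    exact hρ i
  exact (hcont.continuousWithinAt.tendsto_nhdsWithin hmaps).eventually (hF _ (hmaps hρ) t ht)

/-! ### Joint laws of observation and action -/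

/-- The joint law of the observation and the action of a decision maker applying the control
law `g`. -/
noncomputable def graphLaw {Y U : Type*} [MeasurableSpace Y] [MeasurableSpace U] (Q : Measure Y)
    (g : Y → U) : Measure (Y × U) :=
  Q.map fun y => (y, g y)

theorem graphLaw_fst {Y U : Type*} [MeasurableSpace Y] [MeasurableSpace U] (Q : Measure Y)
    {g : Y → U} (hg : Measurable g) : (graphLaw Q g).fst = Q := by
  rw [graphLaw, Measure.fst_map_prodMk hg, Measure.map_id']

theorem isProbabilityMeasure_graphLaw {Y U : Type*} [MeasurableSpace Y] [MeasurableSpace U]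
    (Q : Measure Y) [IsProbabilityMeasure Q] {g : Y → U} (hg : Measurable g) :
    IsProbabilityMeasure (graphLaw Q g) :=
  Measure.isProbabilityMeasure_map (by fun_prop)

/-- The joint laws of observation and action for control laws that satisfy the moment bound
`∫ φ(g(y)) Q(dy) ≤ M`. -/
def boundedGraphLaws {Y U : Type*} [MeasurableSpace Y] [MeasurableSpace U] (Q : Measure Y)
    (φ : U → ℝ≥0) (M : ℝ≥0) : Set (ProbabilityMeasure (Y × U)) :=
  {ν | ∃ g : Y → U, Measurable g ∧ ∫⁻ y, (φ (g y) : ℝ≥0∞) ∂Q ≤ M ∧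
    (ν : Measure (Y × U)) = graphLaw Q g}

/-- A moment bound with a function `φ` that is large off compact sets gives relative
compactness. -/
theorem isCompact_closure_boundedGraphLaws {Y U : Type*}
    [TopologicalSpace Y] [PolishSpace Y] [MeasurableSpace Y] [BorelSpace Y]
    [TopologicalSpace U] [TopologicalSpace.MetrizableSpace U] [SecondCountableTopology U]
    [MeasurableSpace U] [BorelSpace U] (Q : Measure Y) [IsProbabilityMeasure Q]
    {K : ℕ → Set U} (hK : ∀ n, IsCompact (K n)) {φ : U → ℝ≥0}
    (hφK : Tendsto (fun n => ⨅ u ∈ (K n)ᶜ, (φ u : ℝ≥0∞)) atTop (𝓝 ⊤)) (M : ℝ≥0) :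
    IsCompact (closure (boundedGraphLaws Q φ M)) := by
  refine isCompact_closure_of_isTightMeasureSet (IsTightMeasureSet.prodMk ?_ ?_)
  · refine (isTightMeasureSet_singleton (μ := Q)).subset ?_
    rintro _ ⟨_, ⟨ν, ⟨g, hg, -, hν⟩, rfl⟩, rfl⟩
    rw [hν, graphLaw_fst Q hg, Set.mem_singleton_iff]
  · refine isTightMeasureSet_iff_exists_isCompact_measure_compl_le.2 fun ε hε => ?_
    have hlt : (M : ℝ≥0∞) / ε < ⊤ := ENNReal.div_lt_top ENNReal.coe_ne_top hε.ne'
    obtain ⟨n, hn⟩ := (hφK.eventually (lt_mem_nhds hlt)).exists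
    refine ⟨K n, hK n, ?_⟩
    rintro _ ⟨_, ⟨ν, ⟨g, hg, hgM, hν⟩, rfl⟩, rfl⟩
    have hKm : MeasurableSet (K n)ᶜ := (hK n).measurableSet.compl
    set a := ⨅ u ∈ (K n)ᶜ, (φ u : ℝ≥0∞)
    have hval : (ν : Measure (Y × U)).snd (K n)ᶜ = Q (g ⁻¹' (K n)ᶜ) := by
      rw [hν, graphLaw, Measure.snd_map_prodMk measurable_id', Measure.map_apply hg hKm]
    rw [hval]
    have hmarkov : Q (g ⁻¹' (K n)ᶜ) * a ≤ M := calc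
      Q (g ⁻¹' (K n)ᶜ) * a = ∫⁻ _ in g ⁻¹' (K n)ᶜ, a ∂Q := by
        rw [setLIntegral_const, mul_comm]
      _ ≤ ∫⁻ y in g ⁻¹' (K n)ᶜ, (φ (g y) : ℝ≥0∞) ∂Q :=
        setLIntegral_mono' (hg hKm) fun y hy => iInf₂_le (g y) hy
      _ ≤ ∫⁻ y, (φ (g y) : ℝ≥0∞) ∂Q := setLIntegral_le_lintegral _ _
      _ ≤ M := hgM
    have ha : a ≠ 0 := (zero_le.trans_lt hn).ne'
    refine ((ENNReal.le_div_iff_mul_le (.inl ha) (.inr ENNReal.coe_ne_top)).2 hmarkov).trans ?_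
    exact (ENNReal.div_le_iff_le_mul (.inl ha) (.inr hε.ne')).2
      ((ENNReal.div_le_iff_le_mul (.inl hε.ne') (.inr ha)).1 hn.le |>.trans_eq (mul_comm _ _))

/-- Weak limits of joint laws of observation and action have the same law of the observation. -/
theorem fst_eq_of_mem_closure_boundedGraphLaws {Y U : Type*}
    [TopologicalSpace Y] [PolishSpace Y] [MeasurableSpace Y] [BorelSpace Y]
    [TopologicalSpace U] [TopologicalSpace.MetrizableSpace U] [SecondCountableTopology U]
    [MeasurableSpace U] [BorelSpace U] (Q : Measure Y) [IsProbabilityMeasure Q]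
    {φ : U → ℝ≥0} {M : ℝ≥0} {ν : ProbabilityMeasure (Y × U)}
    (hν : ν ∈ closure (boundedGraphLaws Q φ M)) : (ν : Measure (Y × U)).fst = Q := by
  let Q' : ProbabilityMeasure Y := ⟨Q, inferInstance⟩
  have hclosed : IsClosed {ν : ProbabilityMeasure (Y × U) |
      ν.map (continuous_fst.measurable (α := Y × U)).aemeasurable = Q'} :=
    isClosed_eq (ProbabilityMeasure.continuous_map continuous_fst) continuous_const
  have hsub : boundedGraphLaws Q φ M ⊆ {ν : ProbabilityMeasure (Y × U) |
      ν.map (continuous_fst.measurable (α := Y × U)).aemeasurable = Q'} := by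
    rintro ν ⟨g, hg, -, hν⟩
    refine Subtype.ext ?_
    change (ν : Measure (Y × U)).fst = Q
    rw [hν, graphLaw_fst Q hg]
  exact congrArg Subtype.val (closure_minimal hsub hclosed hν)

/-! ### Removing independent randomization -/

/-- Interleaving two independent families of independent coordinates. -/
theorem map_prod_pi_eq_pi_prod {ι : Type*} [Fintype ι] {X Y : ι → Type*}
    [∀ i, MeasurableSpace (X i)] [∀ i, MeasurableSpace (Y i)] (μ : ∀ i, Measure (X i))
    (ν : ∀ i, Measure (Y i)) [∀ i, SigmaFinite (μ i)] [∀ i, SigmaFinite (ν i)] :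
    ((Measure.pi μ).prod (Measure.pi ν)).map (fun p i => (p.1 i, p.2 i)) =
      Measure.pi fun i => (μ i).prod (ν i) := by
  refine (Measure.pi_eq_generateFrom (fun i => generateFrom_prod)
    (fun i => isPiSystem_prod) (fun i => ?_) ?_).symm
  · exact ((μ i).toFiniteSpanningSetsIn.prod (ν i).toFiniteSpanningSetsIn)
  · intro s hs
    choose a ha b hb hab using hs
    have hsm : ∀ i, MeasurableSet (s i) := fun i => hab i ▸ (ha i).prod (hb i)
    rw [Measure.map_apply (by fun_prop) (.univ_pi hsm)]
    have : (fun (p : (∀ i, X i) × (∀ i, Y i)) i => (p.1 i, p.2 i)) ⁻¹' Set.univ.pi s =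
        Set.univ.pi a ×ˢ Set.univ.pi b := by
      ext p
      simp [← hab, forall_and]
    rw [this, Measure.prod_prod, Measure.pi_pi, Measure.pi_pi, ← Finset.prod_mul_distrib]
    exact Finset.prod_congr rfl fun i _ => by rw [← hab, Measure.prod_prod]

/-- Deterministic control laws do at least as well as independently randomized ones. Each
randomized law is a deterministic one that depends on an auxiliary uniform variable `t i`;
the randomized cost is the average over `t` of deterministic costs, so some value of `t` does at
least as well as the average. -/
theorem exists_lintegral_pi_graphLaw_le {ι : Type*} [Fintype ι] {Y U : ι → Type*}
    [∀ i, MeasurableSpace (Y i)] [∀ i, MeasurableSpace (U i)] [∀ i, StandardBorelSpace (U i)]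
    [∀ i, Nonempty (U i)]
    (Q : ∀ i, Measure (Y i)) [∀ i, IsProbabilityMeasure (Q i)]
    (κ : ∀ i, Kernel (Y i) (U i)) [∀ i, IsMarkovKernel (κ i)]
    {C : (∀ i, Y i × U i) → ℝ≥0∞} (hC : Measurable C) :
    ∃ g : ∀ i, Y i → U i, (∀ i, Measurable (g i)) ∧
      ∫⁻ z, C z ∂Measure.pi (fun i => graphLaw (Q i) (g i)) ≤
        ∫⁻ z, C z ∂Measure.pi (fun i => Q i ⊗ₘ κ i) := by
  choose f hf hfκ using fun i => (κ i).exists_measurable_map_eq_unitInterval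
  have hf' : ∀ i, Measurable fun q : unitInterval × Y i => f i q.2 q.1 := fun i =>
    (hf i).comp measurable_swap
  -- The order `(t, y)` of the arguments makes the average over `t` the outer integral below.
  have hlaw : ∀ i, Q i ⊗ₘ κ i =
      ((volume : Measure unitInterval).prod (Q i)).map (fun q => (q.2, f i q.2 q.1)) := by
    intro i
    refine Measure.ext_of_lintegral _ fun h hh => ?_
    rw [Measure.lintegral_compProd hh, lintegral_map hh (by fun_prop),
      lintegral_prod_symm' _ (by fun_prop)]
    refine lintegral_congr fun y => ?_
    have hfy : Measurable (f i y) := (hf i).comp measurable_prodMk_left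
    rw [← hfκ i y, lintegral_map (by fun_prop) hfy]
  have hcost : ∫⁻ z, C z ∂Measure.pi (fun i => Q i ⊗ₘ κ i) =
      ∫⁻ t : ι → unitInterval, ∫⁻ y, C (fun i => (y i, f i (y i) (t i))) ∂Measure.pi Q
        ∂Measure.pi fun _ => volume := by
    simp_rw [hlaw]
    have hprob : ∀ i, IsProbabilityMeasure
        (((volume : Measure unitInterval).prod (Q i)).map (fun q => (q.2, f i q.2 q.1))) :=
      fun i => Measure.isProbabilityMeasure_map (by fun_prop)
    rw [← Measure.pi_map_pi fun i => by fun_prop, ← map_prod_pi_eq_pi_prod,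
      lintegral_map hC (by fun_prop), lintegral_map (by fun_prop) (by fun_prop),
      lintegral_prod _ (by fun_prop)]
  obtain ⟨t, ht⟩ := exists_le_lintegral
    (μ := Measure.pi fun _ : ι => (volume : Measure unitInterval))
    (f := fun t => ∫⁻ y, C (fun i => (y i, f i (y i) (t i))) ∂Measure.pi Q)
    (Measurable.lintegral_prod_right'
      (f := fun p : (ι → unitInterval) × (∀ i, Y i) => C fun i => (p.2 i, f i (p.2 i) (p.1 i)))
      (by fun_prop)).aemeasurable
  have hg : ∀ i, Measurable fun y => f i y (t i) := fun i => by fun_prop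
  refine ⟨fun i y => f i y (t i), hg, ?_⟩
  have hprob := fun i => isProbabilityMeasure_graphLaw (Q i) (hg i)
  unfold graphLaw at hprob ⊢
  rw [hcost, ← Measure.pi_map_pi fun i => by fun_prop, lintegral_map hC (by fun_prop)]
  exact ht

/-! ### Stages of a sequential team -/

/-- If `h` does not depend on the independent coordinate `ω i`, then `h` and `ω i` are
independent. -/
theorem map_prodMk_eq_prod_of_forall_update {Ω₀ ι X : Type*} [Fintype ι] [DecidableEq ι]
    {Ω : ι → Type*} [MeasurableSpace Ω₀] [∀ i, MeasurableSpace (Ω i)] [MeasurableSpace X]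
    (P₀ : Measure Ω₀) [IsProbabilityMeasure P₀] (P : ∀ i, Measure (Ω i))
    [∀ i, IsProbabilityMeasure (P i)] (i : ι) {h : Ω₀ × (∀ i, Ω i) → X} (hm : Measurable h)
    (hu : ∀ ω₀ ω w, h (ω₀, Function.update ω i w) = h (ω₀, ω)) :
    (P₀.prod (Measure.pi P)).map (fun p => (h p, p.2 i)) =
      ((P₀.prod (Measure.pi P)).map h).prod (P i) := by
  have : IsProbabilityMeasure ((P₀.prod (Measure.pi P)).map h) :=
    Measure.isProbabilityMeasure_map hm.aemeasurable
  have hi : Measurable fun p : Ω₀ × (∀ i, Ω i) => p.2 i :=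
    (measurable_pi_apply i).comp measurable_snd
  refine Measure.ext_of_lintegral _ fun F hF => ?_
  have hF' : Measurable fun x => ∫⁻ w, F (x, w) ∂P i := hF.lintegral_prod_right'
  rw [lintegral_map hF (hm.prodMk hi), lintegral_prod _ hF.aemeasurable, lintegral_map hF' hm,
    lintegral_prod _ (by fun_prop), lintegral_prod _ (by fun_prop)]
  refine lintegral_congr fun ω₀ => ?_
  have hmk : Measurable fun ω : ∀ i, Ω i => (ω₀, ω) := measurable_prodMk_left
  refine lintegral_eq_of_lmarginal_eq {i} ((hF.comp (hm.prodMk hi)).comp hmk)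
    ((hF'.comp hm).comp hmk) ?_
  rw [lmarginal_singleton, lmarginal_singleton]
  funext ω
  simp [hu]

namespace Past

variable {N : ℕ} {X : Fin N → Type*}

/-- The profile `x^1, …, x^i` extended by the fixed values `d` of the later coordinates. -/
def extend (d : ∀ k, X k) (i : Fin N) (p : Past X i) (a : X i) : ∀ k, X k :=
  Function.update (fun k => if h : k < i then p ⟨k, h⟩ else d k) i a

/-- The profile `x` with all but the first `n` coordinates reset to the fixed values `d`. -/
def trunc (d : ∀ k, X k) (n : ℕ) (x : ∀ k, X k) : ∀ k, X k :=
  fun k => if k.val < n then x k else d k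

theorem extend_of (d : ∀ k, X k) (i : Fin N) (x : ∀ k, X k) :
    extend d i (of i x) (x i) = trunc d (i + 1) x := by
  funext k
  rcases eq_or_ne k i with rfl | hk
  · simp [extend, trunc]
  · have : k < i ↔ k.val < i + 1 := by
      have := Fin.val_ne_of_ne hk
      rw [Fin.lt_def]
      omega
    by_cases h : k.val < i + 1
    · simp [extend, trunc, hk, h, this.2 h, of]
    · simp [extend, trunc, hk, h, this]

theorem of_trunc (d : ∀ k, X k) (i : Fin N) (x : ∀ k, X k) : of i (trunc d i x) = of i x := by
  funext k
  have : k.1.val < i.val := k.2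
  simp [of, trunc, this]

theorem of_update_of_le {i k : Fin N} (hki : k ≤ i) (x : ∀ k, X k) (a : X i) :
    of k (Function.update x i a) = of k x := by
  funext j
  have : j.1 ≠ i := (j.2.trans_le hki).ne
  simp [of, this]

theorem trunc_of_le (d : ∀ k, X k) {n : ℕ} (hn : N ≤ n) (x : ∀ k, X k) : trunc d n x = x := by
  funext k
  simp [trunc, k.2.trans_le hn]

variable [∀ k, MeasurableSpace (X k)]

@[fun_prop]
theorem measurable_of (i : Fin N) : Measurable (of (X := X) i) :=
  measurable_pi_lambda _ fun k => measurable_pi_apply k.1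

theorem measurable_extend (d : ∀ k, X k) (i : Fin N) :
    Measurable fun q : Past X i × X i => extend d i q.1 q.2 := by
  refine measurable_pi_lambda _ fun k => ?_
  rcases eq_or_ne k i with rfl | hk
  · simpa [extend] using measurable_snd
  · by_cases h : k < i
    · simp only [extend, ne_eq, hk, not_false_eq_true, Function.update_of_ne, h, dite_true]
      exact (measurable_pi_apply _).comp measurable_fst
    · simp [extend, hk, h]

@[fun_prop]
theorem measurable_trunc (d : ∀ k, X k) (n : ℕ) : Measurable (trunc d n) := by
  refine measurable_pi_lambda _ fun k => ?_
  by_cases h : k.val < n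
  · simpa [trunc, h] using measurable_pi_apply k
  · simp [trunc, h]

end Past

namespace SequentialTeam

variable {N : ℕ} {Ω₀ : Type*} {Ω Y U : Fin N → Type*}

/-- What has been realized before decision maker `i` measures, as a function of the complete
outcome. -/
def hist (i : Fin N) (s : Ω₀ × (∀ i, Y i) × (∀ i, U i)) : Past.Hist Ω₀ Y U i :=
  (s.1, Past.of i s.2.1, Past.of i s.2.2)

/-- The outcome assembled from the state `ω₀` and the pairs `(y^i, u^i)`. -/
def assemble (ω₀ : Ω₀) (z : ∀ i, Y i × U i) : Ω₀ × (∀ i, Y i) × (∀ i, U i) :=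
  (ω₀, (fun i => (z i).1), fun i => (z i).2)

theorem hist_assemble_update {i k : Fin N} (hki : k ≤ i) (ω₀ : Ω₀) (z : ∀ i, Y i × U i)
    (w : Y i × U i) : hist k (assemble ω₀ (Function.update z i w)) = hist k (assemble ω₀ z) := by
  have h := Past.of_update_of_le hki z w
  exact Prod.ext rfl (Prod.ext (funext fun j => congrArg Prod.fst (congrFun h j))
    (funext fun j => congrArg Prod.snd (congrFun h j)))

variable [MeasurableSpace Ω₀] [∀ i, MeasurableSpace (Ω i)] [∀ i, MeasurableSpace (Y i)]
  [∀ i, MeasurableSpace (U i)]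

@[fun_prop]
theorem measurable_hist (i : Fin N) : Measurable (hist (Ω₀ := Ω₀) (Y := Y) (U := U) i) := by
  unfold hist
  fun_prop

instance (T : SequentialTeam N Ω₀ Ω Y U) (i : Fin N) : IsMarkovKernel (T.channel i) :=
  Kernel.IsMarkovKernel.map _ (T.measurable_η i)

theorem lintegral_channel (T : SequentialTeam N Ω₀ Ω Y U) (i : Fin N) (h : Past.Hist Ω₀ Y U i)
    {F : Y i → ℝ≥0∞} (hF : Measurable F) :
    ∫⁻ y, F y ∂T.channel i h = ∫⁻ w, F (T.η i (h, w)) ∂T.P i := by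
  have hη := T.measurable_η i
  rw [channel, Kernel.map_apply _ hη, lintegral_map hF hη, Kernel.prod_apply, Kernel.id_apply,
    Kernel.const_apply, lintegral_prod _ (by fun_prop), lintegral_dirac' _ ?_]
  exact (hF.comp hη).lintegral_prod_right'

/-! ### The law of the outcome of a deterministic policy -/

theorem outcome_eq (T : SequentialTeam N Ω₀ Ω Y U) (γ : T.Policy) (ω₀ : Ω₀) (ω : ∀ i, Ω i)
    (i : Fin N) :
    T.outcome γ ω₀ ω i =
      (T.η i ((ω₀, (fun k => (T.outcome γ ω₀ ω k.1).1), fun k => (T.outcome γ ω₀ ω k.1).2), ω i),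
        (γ i).1 (T.η i ((ω₀, (fun k => (T.outcome γ ω₀ ω k.1).1),
          fun k => (T.outcome γ ω₀ ω k.1).2), ω i))) := by
  rw [outcome]

/-- The complete outcome `(ω₀, y, u)` as a function of the exogenous variables. -/
def fullOutcome (T : SequentialTeam N Ω₀ Ω Y U) (γ : T.Policy) (p : Ω₀ × (∀ i, Ω i)) :
    Ω₀ × (∀ i, Y i) × (∀ i, U i) :=
  (p.1, (fun i => (T.outcome γ p.1 p.2 i).1), fun i => (T.outcome γ p.1 p.2 i).2)

theorem outcome_eq_hist (T : SequentialTeam N Ω₀ Ω Y U) (γ : T.Policy) (p : Ω₀ × (∀ i, Ω i))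
    (i : Fin N) :
    T.outcome γ p.1 p.2 i = (T.η i (hist i (T.fullOutcome γ p), p.2 i),
      (γ i).1 (T.η i (hist i (T.fullOutcome γ p), p.2 i))) :=
  T.outcome_eq γ p.1 p.2 i

theorem measurable_outcome (T : SequentialTeam N Ω₀ Ω Y U) (γ : T.Policy) (i : Fin N) :
    Measurable fun p : Ω₀ × (∀ i, Ω i) => T.outcome γ p.1 p.2 i := by
  induction i using WellFoundedLT.induction with
  | ind i ih =>
    have hy : Measurable fun p : Ω₀ × (∀ i, Ω i) =>
        T.η i ((p.1, (fun k : {k : Fin N // k < i} => (T.outcome γ p.1 p.2 k.1).1),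
          fun k : {k : Fin N // k < i} => (T.outcome γ p.1 p.2 k.1).2), p.2 i) := by
      refine (T.measurable_η i).comp (Measurable.prodMk (measurable_fst.prodMk
        (Measurable.prodMk (measurable_pi_lambda _ fun k => (ih k.1 k.2).fst)
          (measurable_pi_lambda _ fun k => (ih k.1 k.2).snd))) ?_)
      fun_prop
    simp_rw [T.outcome_eq γ _ _ i]
    exact hy.prodMk ((γ i).2.comp hy)

theorem measurable_fullOutcome (T : SequentialTeam N Ω₀ Ω Y U) (γ : T.Policy) :
    Measurable (T.fullOutcome γ) :=
  measurable_fst.prodMk (Measurable.prodMk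
    (measurable_pi_lambda _ fun i => (T.measurable_outcome γ i).fst)
    (measurable_pi_lambda _ fun i => (T.measurable_outcome γ i).snd))

/-- The outcome of decision makers before `i` does not depend on the noise `ω i`. -/
theorem outcome_update_of_lt (T : SequentialTeam N Ω₀ Ω Y U) (γ : T.Policy) (ω₀ : Ω₀)
    (ω : ∀ i, Ω i) {i k : Fin N} (w : Ω i) (hk : k < i) :
    T.outcome γ ω₀ (Function.update ω i w) k = T.outcome γ ω₀ ω k := by
  induction k using WellFoundedLT.induction with
  | ind k ih =>
    have h : ∀ j : {j : Fin N // j < k},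
        T.outcome γ ω₀ (Function.update ω i w) j.1 = T.outcome γ ω₀ ω j.1 :=
      fun j => ih j.1 j.2 (j.2.trans hk)
    rw [T.outcome_eq, T.outcome_eq γ ω₀ ω k]
    simp [h, hk.ne]

theorem isStrategicMeasure_map_fullOutcome (T : SequentialTeam N Ω₀ Ω Y U) (γ : T.Policy) :
    T.IsStrategicMeasure (fun i => Kernel.deterministic (γ i).1 (γ i).2)
      ((T.P₀.prod (Measure.pi T.P)).map (T.fullOutcome γ)) := by
  have hm := T.measurable_fullOutcome γ
  have hprob : IsProbabilityMeasure ((T.P₀.prod (Measure.pi T.P)).map (T.fullOutcome γ)) :=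
    Measure.isProbabilityMeasure_map hm.aemeasurable
  refine ⟨?_, fun i => ?_, fun i => ?_⟩
  · rw [Measure.map_map measurable_fst hm]
    exact Measure.fst_prod
  · have hh : Measurable fun p => hist i (T.fullOutcome γ p) := (measurable_hist i).comp hm
    change (Measure.map (T.fullOutcome γ) (T.P₀.prod (Measure.pi T.P))).map
      (fun s => (hist i s, s.2.1 i)) = ((T.P₀.prod (Measure.pi T.P)).map (T.fullOutcome γ)).map
        (hist i) ⊗ₘ T.channel i
    rw [Measure.map_map (by fun_prop) hm, Measure.map_map (by fun_prop) hm]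
    have hcomp : (fun s : Ω₀ × (∀ i, Y i) × (∀ i, U i) => (hist i s, s.2.1 i)) ∘ T.fullOutcome γ =
        (fun q : Past.Hist Ω₀ Y U i × Ω i => (q.1, T.η i q)) ∘
          fun p => (hist i (T.fullOutcome γ p), p.2 i) := by
      funext p
      exact Prod.ext rfl (congrArg Prod.fst (T.outcome_eq_hist γ p i))
    have hη := T.measurable_η i
    have hi : Measurable fun p : Ω₀ × (∀ i, Ω i) => p.2 i := by fun_prop
    rw [hcomp, ← Measure.map_map (by fun_prop) (hh.prodMk hi),
      map_prodMk_eq_prod_of_forall_update T.P₀ T.P i hh]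
    · have : IsProbabilityMeasure ((T.P₀.prod (Measure.pi T.P)).map
          fun p => hist i (T.fullOutcome γ p)) := Measure.isProbabilityMeasure_map hh.aemeasurable
      refine Measure.ext_of_lintegral _ fun F hF => ?_
      rw [lintegral_map hF (by fun_prop), lintegral_prod _ (by fun_prop),
        Measure.lintegral_compProd hF]
      refine lintegral_congr fun h => ?_
      exact (T.lintegral_channel i h (hF.comp measurable_prodMk_left)).symm
    · intro ω₀ ω w
      have h : ∀ j : {j : Fin N // j < i},
          T.outcome γ ω₀ (Function.update ω i w) j.1 = T.outcome γ ω₀ ω j.1 :=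
        fun j => T.outcome_update_of_lt γ ω₀ ω w j.2
      exact Prod.ext rfl (Prod.ext (funext fun j => congrArg Prod.fst (h j))
        (funext fun j => congrArg Prod.snd (h j)))
  · change (Measure.map (T.fullOutcome γ) (T.P₀.prod (Measure.pi T.P))).map
      (fun s => ((hist i s, s.2.1 i), s.2.2 i)) =
        ((T.P₀.prod (Measure.pi T.P)).map (T.fullOutcome γ)).map (fun s => (hist i s, s.2.1 i)) ⊗ₘ _
    have hp : Measurable fun s : Ω₀ × (∀ i, Y i) × (∀ i, U i) => (hist i s, s.2.1 i) := by fun_prop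
    have : IsProbabilityMeasure (((T.P₀.prod (Measure.pi T.P)).map (T.fullOutcome γ)).map
        fun s => (hist i s, s.2.1 i)) := Measure.isProbabilityMeasure_map hp.aemeasurable
    refine Measure.ext_of_lintegral _ fun F hF => ?_
    have hγ := (γ i).2
    rw [Measure.lintegral_compProd hF]
    simp_rw [Kernel.prodMkLeft_apply, Kernel.deterministic_apply]
    have hdirac : ∀ q : Past.Hist Ω₀ Y U i × Y i,
        ∫⁻ u, F (q, u) ∂Measure.dirac ((γ i).1 q.2) = F (q, (γ i).1 q.2) := fun q =>
      lintegral_dirac' _ (hF.comp measurable_prodMk_left)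
    have hF' : Measurable fun q : Past.Hist Ω₀ Y U i × Y i => F (q, (γ i).1 q.2) := by fun_prop
    simp_rw [hdirac]
    rw [lintegral_map hF (by fun_prop), lintegral_map hF' hp,
      lintegral_map (by fun_prop) hm, lintegral_map (by fun_prop) hm]
    refine lintegral_congr fun p => ?_
    have hu : (T.fullOutcome γ p).2.2 i = (γ i).1 ((T.fullOutcome γ p).2.1 i) := by
      simp only [fullOutcome, T.outcome_eq γ p.1 p.2 i]
    rw [hu]

theorem J_eq_lintegral_map (T : SequentialTeam N Ω₀ Ω Y U) (γ : T.Policy) :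
    T.J γ = ∫⁻ s, (T.c s : ℝ≥0∞) ∂(T.P₀.prod (Measure.pi T.P)).map (T.fullOutcome γ) := by
  rw [lintegral_map T.measurable_c.coe_nnreal_ennreal (T.measurable_fullOutcome γ)]
  rfl

/-! ### Change of measure to the reduced team -/

@[fun_prop]
theorem measurable_assemble (ω₀ : Ω₀) : Measurable (assemble (Y := Y) (U := U) ω₀) := by
  unfold assemble
  fun_prop

/-- The density of the first `n` measurements with respect to the reference measures. -/
noncomputable def partialDensity {T : SequentialTeam N Ω₀ Ω Y U} (R : T.IndependentReduction)
    (n : ℕ) (s : Ω₀ × (∀ i, Y i) × (∀ i, U i)) : ℝ≥0∞ :=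
  ∏ k with k.val < n, (R.f k (hist k s, s.2.1 k) : ℝ≥0∞)

@[fun_prop]
theorem measurable_partialDensity {T : SequentialTeam N Ω₀ Ω Y U} (R : T.IndependentReduction)
    (n : ℕ) : Measurable (partialDensity R n) := by
  unfold partialDensity
  refine Finset.measurable_prod _ fun k _ => ?_
  exact ((R.measurable_f k).comp (by fun_prop)).coe_nnreal_ennreal

theorem partialDensity_update {T : SequentialTeam N Ω₀ Ω Y U} (R : T.IndependentReduction)
    (i : Fin N) (ω₀ : Ω₀) (z : ∀ i, Y i × U i) (w : Y i × U i) :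
    partialDensity R i (assemble ω₀ (Function.update z i w)) =
      partialDensity R i (assemble ω₀ z) := by
  refine Finset.prod_congr rfl fun k hk => ?_
  have hki : k < i := (Finset.mem_filter.1 hk).2
  rw [hist_assemble_update hki.le]
  simp [assemble, hki.ne]

theorem partialDensity_succ {T : SequentialTeam N Ω₀ Ω Y U} (R : T.IndependentReduction)
    (i : Fin N) (s : Ω₀ × (∀ i, Y i) × (∀ i, U i)) :
    partialDensity R (i + 1) s = R.f i (hist i s, s.2.1 i) * partialDensity R i s := by
  have : (Finset.univ.filter fun k : Fin N => k.val < i + 1) =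
      insert i (Finset.univ.filter fun k : Fin N => k.val < i) := by
    ext k
    simp only [Finset.mem_filter, Finset.mem_univ, true_and, Finset.mem_insert, Fin.ext_iff]
    omega
  rw [partialDensity, this, Finset.prod_insert (by simp)]
  rfl

/-- Under a strategic measure, integrating a function of the first `i + 1` stages amounts to
integrating out the action and the measurement of decision maker `i`. -/
theorem IsStrategicMeasure.lintegral_stage {T : SequentialTeam N Ω₀ Ω Y U}
    {κ : ∀ i, Kernel (Y i) (U i)} [∀ i, IsMarkovKernel (κ i)]
    {μ : Measure (Ω₀ × (∀ i, Y i) × (∀ i, U i))} [IsProbabilityMeasure μ]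
    (hμ : T.IsStrategicMeasure κ μ) (i : Fin N)
    {F : (Past.Hist Ω₀ Y U i × Y i) × U i → ℝ≥0∞} (hF : Measurable F) :
    ∫⁻ s, F ((hist i s, s.2.1 i), s.2.2 i) ∂μ =
      ∫⁻ s, ∫⁻ y, ∫⁻ u, F ((hist i s, y), u) ∂κ i y ∂T.channel i (hist i s) ∂μ := by
  have h₁ : μ.map (fun s => (hist i s, s.2.1 i)) = μ.map (hist i) ⊗ₘ T.channel i :=
    hμ.law_measurement i
  have h₂ : μ.map (fun s => ((hist i s, s.2.1 i), s.2.2 i)) =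
      μ.map (fun s => (hist i s, s.2.1 i)) ⊗ₘ Kernel.prodMkLeft (Past.Hist Ω₀ Y U i) (κ i) :=
    hμ.law_action i
  have hF₁ : Measurable fun q : Past.Hist Ω₀ Y U i × Y i => ∫⁻ u, F (q, u) ∂κ i q.2 :=
    hF.lintegral_kernel_prod_right' (κ := Kernel.prodMkLeft (Past.Hist Ω₀ Y U i) (κ i))
  have hF₂ : Measurable fun h => ∫⁻ y, ∫⁻ u, F ((h, y), u) ∂κ i y ∂T.channel i h :=
    hF₁.lintegral_kernel_prod_right'
  have := Measure.isProbabilityMeasure_map (μ := μ) (measurable_hist i).aemeasurable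
  have hp : Measurable fun s : Ω₀ × (∀ i, Y i) × (∀ i, U i) => (hist i s, s.2.1 i) := by fun_prop
  have := Measure.isProbabilityMeasure_map (μ := μ) hp.aemeasurable
  calc ∫⁻ s, F ((hist i s, s.2.1 i), s.2.2 i) ∂μ
      = ∫⁻ q, F q ∂μ.map (fun s => ((hist i s, s.2.1 i), s.2.2 i)) :=
        (lintegral_map hF (by fun_prop)).symm
    _ = ∫⁻ q, ∫⁻ u, F (q, u) ∂κ i q.2 ∂μ.map (fun s => (hist i s, s.2.1 i)) := by
        rw [h₂, Measure.lintegral_compProd hF]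
        rfl
    _ = ∫⁻ h, ∫⁻ y, ∫⁻ u, F ((h, y), u) ∂κ i y ∂T.channel i h ∂μ.map (hist i) := by
        rw [h₁, Measure.lintegral_compProd hF₁]
    _ = _ := lintegral_map hF₂ (by fun_prop)

/-- The reference measures are probability measures, so default values for the measurements
exist. -/
theorem IndependentReduction.nonempty {T : SequentialTeam N Ω₀ Ω Y U}
    (R : T.IndependentReduction) (i : Fin N) : Nonempty (Y i) :=
  (R.Q i).nonempty_of_neZero

/-- Change of measure for functions of the first `n` stages. The induction step replaces the
measurement channel of the next decision maker by its density; a function of the first `n` stages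
is encoded as one that sees the later stages reset to fixed values. -/
theorem IsStrategicMeasure.lintegral_trunc {T : SequentialTeam N Ω₀ Ω Y U}
    (R : T.IndependentReduction) {κ : ∀ i, Kernel (Y i) (U i)} [∀ i, IsMarkovKernel (κ i)]
    {μ : Measure (Ω₀ × (∀ i, Y i) × (∀ i, U i))} [IsProbabilityMeasure μ]
    (hμ : T.IsStrategicMeasure κ μ) (dY : ∀ i, Y i) (dU : ∀ i, U i) {n : ℕ} (hn : n ≤ N)
    {F : Ω₀ × (∀ i, Y i) × (∀ i, U i) → ℝ≥0∞} (hF : Measurable F) :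
    ∫⁻ s, F (s.1, Past.trunc dY n s.2.1, Past.trunc dU n s.2.2) ∂μ =
      ∫⁻ ω₀, ∫⁻ z, F (ω₀, Past.trunc dY n (fun i => (z i).1), Past.trunc dU n (fun i => (z i).2)) *
        partialDensity R n (assemble ω₀ z) ∂Measure.pi (fun i => R.Q i ⊗ₘ κ i) ∂T.P₀ := by
  induction n generalizing F with
  | zero =>
    have hY : ∀ x, Past.trunc dY 0 x = dY := fun x => by funext k; simp [Past.trunc]
    have hU : ∀ x, Past.trunc dU 0 x = dU := fun x => by funext k; simp [Past.trunc]
    simp only [hY, hU, partialDensity, not_lt_zero, Finset.filter_false, Finset.prod_empty, mul_one,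
      lintegral_const, measure_univ]
    rw [← hμ.law_state, lintegral_map (by fun_prop) measurable_fst]
  | succ n ih =>
    obtain ⟨i, rfl⟩ : ∃ i : Fin N, i.val = n := ⟨⟨n, hn⟩, rfl⟩
    let F' : (Past.Hist Ω₀ Y U i × Y i) × U i → ℝ≥0∞ := fun q =>
      F (q.1.1.1, Past.extend dY i q.1.1.2.1 q.1.2, Past.extend dU i q.1.1.2.2 q.2)
    have hF' : Measurable F' := by
      have hY := Past.measurable_extend dY i
      have hU := Past.measurable_extend dU i
      refine hF.comp (Measurable.prodMk (by fun_prop) (Measurable.prodMk ?_ ?_))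
      · exact hY.comp (g := fun q : Past Y i × Y i => Past.extend dY i q.1 q.2)
          (f := fun q : (Past.Hist Ω₀ Y U i × Y i) × U i => (q.1.1.2.1, q.1.2)) (by fun_prop)
      · exact hU.comp (g := fun q : Past U i × U i => Past.extend dU i q.1 q.2)
          (f := fun q : (Past.Hist Ω₀ Y U i × Y i) × U i => (q.1.1.2.2, q.2)) (by fun_prop)
    have hFF' : ∀ s : Ω₀ × (∀ i, Y i) × (∀ i, U i),
        F (s.1, Past.trunc dY (i + 1) s.2.1, Past.trunc dU (i + 1) s.2.2) =
          F' ((hist i s, s.2.1 i), s.2.2 i) := by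
      intro s
      rw [← Past.extend_of, ← Past.extend_of]
      rfl
    have hF₁ : Measurable fun q : Past.Hist Ω₀ Y U i × Y i => ∫⁻ u, F' (q, u) ∂κ i q.2 :=
      hF'.lintegral_kernel_prod_right' (κ := Kernel.prodMkLeft (Past.Hist Ω₀ Y U i) (κ i))
    let Φ : Past.Hist Ω₀ Y U i → ℝ≥0∞ := fun h =>
      ∫⁻ y, ∫⁻ u, F' ((h, y), u) ∂κ i y ∂T.channel i h
    have hΦ : Measurable Φ := hF₁.lintegral_kernel_prod_right'
    have htrunc : ∀ s : Ω₀ × (∀ i, Y i) × (∀ i, U i),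
        hist i (s.1, Past.trunc dY i s.2.1, Past.trunc dU i s.2.2) = hist i s := by
      intro s
      simp only [hist, Past.of_trunc]
    have hΦi := ih (Nat.le_of_succ_le hn) (hΦ.comp (measurable_hist i))
    have htruncz : ∀ ω₀ (z : ∀ i, Y i × U i), hist i (ω₀, Past.trunc dY i (fun k => (z k).1),
        Past.trunc dU i (fun k => (z k).2)) = hist i (assemble ω₀ z) := fun ω₀ z =>
      htrunc (assemble ω₀ z)
    simp only [Function.comp_apply, htrunc, htruncz] at hΦi
    rw [lintegral_congr hFF', hμ.lintegral_stage i hF']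
    refine hΦi.trans (lintegral_congr_ae ?_)
    filter_upwards [R.channel_eq i] with ω₀ hω₀
    -- For fixed `ω₀`, the two integrands agree after integrating out the coordinate `i`.
    have hf := R.measurable_f i
    have hΦω : ∀ z : ∀ i, Y i × U i, Φ (hist i (assemble ω₀ z)) =
        ∫⁻ w, R.f i (hist i (assemble ω₀ z), w.1) * F' ((hist i (assemble ω₀ z), w.1), w.2)
          ∂(R.Q i ⊗ₘ κ i) := by
      intro z
      set h := hist i (assemble ω₀ z) with hh
      have hch : T.channel i h = (R.Q i).withDensity fun y => (R.f i (h, y) : ℝ≥0∞) := hω₀ _ _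
      change ∫⁻ y, ∫⁻ u, F' ((h, y), u) ∂κ i y ∂T.channel i h = _
      have hFh : Measurable fun y => ∫⁻ u, F' ((h, y), u) ∂κ i y := hF₁.comp measurable_prodMk_left
      have hfh : Measurable fun y => (R.f i (h, y) : ℝ≥0∞) := by fun_prop
      rw [hch, lintegral_withDensity_eq_lintegral_mul _ hfh hFh,
        Measure.lintegral_compProd (by fun_prop)]
      refine lintegral_congr fun y => ?_
      have hFy : Measurable fun u => F' ((h, y), u) := by fun_prop
      exact (lintegral_const_mul _ hFy).symm
    refine lintegral_eq_of_lmarginal_eq {i} (by fun_prop) (by fun_prop) ?_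
    rw [lmarginal_singleton, lmarginal_singleton]
    funext z
    have hR : ∀ w : Y i × U i,
        F (ω₀, Past.trunc dY (i + 1) (fun k => (Function.update z i w k).1),
            Past.trunc dU (i + 1) (fun k => (Function.update z i w k).2)) *
          partialDensity R (i + 1) (assemble ω₀ (Function.update z i w)) =
        R.f i (hist i (assemble ω₀ z), w.1) * F' ((hist i (assemble ω₀ z), w.1), w.2) *
          partialDensity R i (assemble ω₀ z) := by
      intro w
      have h₁ := hFF' (assemble ω₀ (Function.update z i w))
      have h₂ : (assemble ω₀ (Function.update z i w)).2.1 i = w.1 := by simp [assemble]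
      have h₃ : (assemble ω₀ (Function.update z i w)).2.2 i = w.2 := by simp [assemble]
      rw [hist_assemble_update le_rfl, h₂, h₃] at h₁
      rw [partialDensity_succ, partialDensity_update, hist_assemble_update le_rfl, h₂, ← h₁]
      simp only [assemble]
      ring
    have hL : ∀ w : Y i × U i, Φ (hist i (assemble ω₀ (Function.update z i w))) *
          partialDensity R i (assemble ω₀ (Function.update z i w)) =
        Φ (hist i (assemble ω₀ z)) * partialDensity R i (assemble ω₀ z) := by
      intro w
      rw [partialDensity_update, hist_assemble_update le_rfl]
    simp only [hR, hL]
    rw [lintegral_const, measure_univ, mul_one, hΦω, lintegral_mul_const _ (by fun_prop)]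

/-- The cost of the reduced team, averaged over the state `ω₀`. -/
noncomputable def IndependentReduction.meanCost {T : SequentialTeam N Ω₀ Ω Y U}
    (R : T.IndependentReduction) (z : ∀ i, Y i × U i) : ℝ≥0∞ :=
  ∫⁻ ω₀, R.cost ω₀ (fun i => (z i).1) (fun i => (z i).2) ∂T.P₀

theorem IndependentReduction.measurable_cost {T : SequentialTeam N Ω₀ Ω Y U}
    (R : T.IndependentReduction) :
    Measurable fun p : Ω₀ × (∀ i, Y i × U i) =>
      (R.cost p.1 (fun i => (p.2 i).1) (fun i => (p.2 i).2) : ℝ≥0∞) := by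
  have hs : Measurable fun p : Ω₀ × (∀ i, Y i × U i) => assemble p.1 p.2 := by
    unfold assemble
    fun_prop
  refine Measurable.coe_nnreal_ennreal ((T.measurable_c.comp hs).mul ?_)
  refine Finset.measurable_prod _ fun i _ => (R.measurable_f i).comp ?_
  exact ((measurable_hist i).comp hs).prodMk (by fun_prop)

theorem IndependentReduction.measurable_meanCost {T : SequentialTeam N Ω₀ Ω Y U}
    (R : T.IndependentReduction) : Measurable R.meanCost :=
  R.measurable_cost.lintegral_prod_left'

/-- The expected cost of an individually randomized policy, computed in the reduced team, where
the pairs `(y^i, u^i)` are independent. -/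
theorem IsStrategicMeasure.lintegral_cost {T : SequentialTeam N Ω₀ Ω Y U}
    (R : T.IndependentReduction) {κ : ∀ i, Kernel (Y i) (U i)} [∀ i, IsMarkovKernel (κ i)]
    [∀ i, Nonempty (U i)] {μ : Measure (Ω₀ × (∀ i, Y i) × (∀ i, U i))}
    (hμ : T.IsStrategicMeasure κ μ) :
    ∫⁻ s, (T.c s : ℝ≥0∞) ∂μ = ∫⁻ z, R.meanCost z ∂Measure.pi (fun i => R.Q i ⊗ₘ κ i) := by
  have hprob : IsProbabilityMeasure μ := by
    refine ⟨?_⟩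
    have h := congrArg (fun m : Measure Ω₀ => m Set.univ) hμ.law_state
    simpa [Measure.map_apply measurable_fst MeasurableSet.univ] using h
  have hne := R.nonempty
  have h := hμ.lintegral_trunc R (fun i => Classical.arbitrary (Y i))
    (fun i => Classical.arbitrary (U i)) le_rfl T.measurable_c.coe_nnreal_ennreal
  simp only [Past.trunc_of_le _ le_rfl] at h
  unfold IndependentReduction.meanCost
  rw [h, ← lintegral_lintegral_swap (f := fun ω₀ (z : ∀ i, Y i × U i) =>
    (R.cost ω₀ (fun i => (z i).1) (fun i => (z i).2) : ℝ≥0∞)) R.measurable_cost.aemeasurable]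
  refine lintegral_congr fun ω₀ => lintegral_congr fun z => ?_
  simp [partialDensity, IndependentReduction.cost, hist, assemble]

/-- The expected cost of a deterministic policy, computed in the reduced team. -/
theorem J_eq_lintegral_meanCost {T : SequentialTeam N Ω₀ Ω Y U} (R : T.IndependentReduction)
    [∀ i, Nonempty (U i)] (γ : T.Policy) :
    T.J γ = ∫⁻ z, R.meanCost z ∂Measure.pi (fun i => graphLaw (R.Q i) (γ i).1) := by
  rw [T.J_eq_lintegral_map, (T.isStrategicMeasure_map_fullOutcome γ).lintegral_cost R]
  congr 2
  funext i
  rw [Measure.compProd_deterministic]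
  rfl

/-- By Fatou's lemma, averaging over `ω₀` preserves lower semicontinuity in the actions. -/
theorem IndependentReduction.lowerSemicontinuous_meanCost {T : SequentialTeam N Ω₀ Ω Y U}
    (R : T.IndependentReduction) [∀ i, TopologicalSpace (U i)] [∀ i, FirstCountableTopology (U i)]
    (hlsc : ∀ (ω₀ : Ω₀) (y : ∀ i, Y i), LowerSemicontinuous (R.cost ω₀ y)) (y : ∀ i, Y i) :
    LowerSemicontinuous fun u : ∀ i, U i => R.meanCost fun i => (y i, u i) := by
  refine lowerSemicontinuous_iff_le_liminf.2 fun u => ?_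
  have hm : ∀ u : ∀ i, U i, Measurable fun ω₀ => (R.cost ω₀ y u : ℝ≥0∞) := fun u =>
    R.measurable_cost.comp (measurable_prodMk_right (y := fun i => (y i, u i)))
  have hl : ∀ ω₀, LowerSemicontinuous fun u => (R.cost ω₀ y u : ℝ≥0∞) := fun ω₀ =>
    ENNReal.continuous_coe.comp_lowerSemicontinuous (hlsc ω₀ y) ENNReal.coe_mono
  calc R.meanCost (fun i => (y i, u i))
      ≤ ∫⁻ ω₀, liminf (fun u => (R.cost ω₀ y u : ℝ≥0∞)) (𝓝 u) ∂T.P₀ :=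
        lintegral_mono fun ω₀ => (hl ω₀).le_liminf u
    _ ≤ _ := lintegral_liminf_le hm

/-! ### Existence of an optimal policy -/

/-- Deterministic policies do at least as well as independent randomization in the reduced
team. -/
theorem exists_J_le_lintegral_meanCost {T : SequentialTeam N Ω₀ Ω Y U} (R : T.IndependentReduction)
    [∀ i, Nonempty (U i)] [∀ i, StandardBorelSpace (U i)]
    (κ : ∀ i, Kernel (Y i) (U i)) [∀ i, IsMarkovKernel (κ i)] :
    ∃ γ : T.Policy, T.J γ ≤ ∫⁻ z, R.meanCost z ∂Measure.pi (fun i => R.Q i ⊗ₘ κ i) := by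
  obtain ⟨g, hg, hle⟩ := exists_lintegral_pi_graphLaw_le R.Q κ R.measurable_meanCost
  exact ⟨fun i => ⟨g i, hg i⟩, (J_eq_lintegral_meanCost R _).trans_le hle⟩

/-- Some policy does at least as well as all policies that satisfy the moment bounds: the joint
laws of observation and action of such policies lie in a compact set, on which the expected cost
attains its minimum; the minimizer is independently randomized, and randomization can be removed. -/
theorem exists_forall_J_le {T : SequentialTeam N Ω₀ Ω Y U} (R : T.IndependentReduction)
    [∀ i, TopologicalSpace (Y i)] [∀ i, PolishSpace (Y i)] [∀ i, BorelSpace (Y i)]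
    [∀ i, Nonempty (U i)] [∀ i, TopologicalSpace (U i)]
    [∀ i, TopologicalSpace.MetrizableSpace (U i)] [∀ i, SecondCountableTopology (U i)]
    [∀ i, BorelSpace (U i)] [∀ i, StandardBorelSpace (U i)]
    (hlsc : ∀ (ω₀ : Ω₀) (y : ∀ i, Y i), LowerSemicontinuous (R.cost ω₀ y))
    {K : ∀ i, ℕ → Set (U i)} (hK : ∀ i n, IsCompact (K i n)) {φ : ∀ i, U i → ℝ≥0}
    (hφK : ∀ i, Tendsto (fun n => ⨅ u ∈ (K i n)ᶜ, (φ i u : ℝ≥0∞)) atTop (𝓝 ⊤)) (M : ℝ≥0) :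
    ∃ γ : T.Policy, ∀ γ' : T.Policy,
      (∀ i, ∫⁻ y, (φ i ((γ' i).1 y) : ℝ≥0∞) ∂(R.Q i) ≤ M) → T.J γ ≤ T.J γ' := by
  by_cases hne : ∃ γ₀ : T.Policy, ∀ i, ∫⁻ y, (φ i ((γ₀ i).1 y) : ℝ≥0∞) ∂(R.Q i) ≤ M
  swap
  -- No policy satisfies the bounds, and the claim is void.
  · exact ⟨fun i => ⟨fun _ => Classical.arbitrary (U i), measurable_const⟩,
      fun γ' hγ' => absurd ⟨γ', hγ'⟩ hne⟩
  let law : T.Policy → ∀ i, ProbabilityMeasure (Y i × U i) := fun γ i =>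
    ⟨graphLaw (R.Q i) (γ i).1, isProbabilityMeasure_graphLaw _ (γ i).2⟩
  let 𝒦 : Set (∀ i, ProbabilityMeasure (Y i × U i)) :=
    Set.univ.pi fun i => closure (boundedGraphLaws (R.Q i) (φ i) M)
  have hlaw : ∀ γ : T.Policy, (∀ i, ∫⁻ y, (φ i ((γ i).1 y) : ℝ≥0∞) ∂(R.Q i) ≤ M) → law γ ∈ 𝒦 :=
    fun γ hγ i _ => subset_closure ⟨(γ i).1, (γ i).2, hγ i, rfl⟩
  have hfst : 𝒦 ⊆ {ρ | ∀ i, (ρ i : Measure (Y i × U i)).fst = R.Q i} := fun ρ hρ i =>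
    fst_eq_of_mem_closure_boundedGraphLaws (R.Q i) (hρ i trivial)
  obtain ⟨γ₀, hγ₀⟩ := hne
  obtain ⟨ρ, hρ, hmin⟩ := ((lowerSemicontinuousOn_lintegral_pi R.Q R.measurable_meanCost
    (R.lowerSemicontinuous_meanCost hlsc)).mono hfst).exists_isMinOn ⟨_, hlaw γ₀ hγ₀⟩
    (isCompact_univ_pi fun i => isCompact_closure_boundedGraphLaws (R.Q i) (hK i) (hφK i) M)
  have hdis : ∀ i, R.Q i ⊗ₘ (ρ i : Measure (Y i × U i)).condKernel = ρ i := by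
    intro i
    have h := (ρ i : Measure (Y i × U i)).disintegrate (ρ i : Measure (Y i × U i)).condKernel
    rwa [hfst hρ i] at h
  obtain ⟨γ, hγ⟩ := exists_J_le_lintegral_meanCost R
    fun i => (ρ i : Measure (Y i × U i)).condKernel
  simp_rw [hdis] at hγ
  refine ⟨γ, fun γ' hγ' => hγ.trans ?_⟩
  rw [J_eq_lintegral_meanCost R γ']
  exact hmin (hlaw γ' hγ')

end SequentialTeam

theorem mainTheorem3 {N : ℕ} {Ω₀ : Type*} {Ω Y U : Fin N → Type*}
    [MeasurableSpace Ω₀] [∀ i, MeasurableSpace (Ω i)]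
    [∀ i, MeasurableSpace (Y i)] [∀ i, StandardBorelSpace (Y i)]
    [∀ i, Nonempty (U i)] [∀ i, TopologicalSpace (U i)]
    [∀ i, TopologicalSpace.MetrizableSpace (U i)] [∀ i, SecondCountableTopology (U i)]
    [∀ i, MeasurableSpace (U i)] [∀ i, BorelSpace (U i)] [∀ i, StandardBorelSpace (U i)]
    (T : SequentialTeam N Ω₀ Ω Y U) (R : T.IndependentReduction)
    (hlsc : ∀ (ω₀ : Ω₀) (y : ∀ i, Y i), LowerSemicontinuous (R.cost ω₀ y))
    (K : ∀ i, ℕ → Set (U i)) (hKc : ∀ i n, IsCompact (K i n)) (hKm : ∀ i, Monotone (K i))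
    (hKu : ∀ i, ⋃ n, K i n = Set.univ)
    (φ : ∀ i, U i → ℝ≥0) (hφ : ∀ i, LowerSemicontinuous (φ i))
    (hφK : ∀ i, Tendsto (fun n => ⨅ u ∈ (K i n)ᶜ, (φ i u : ℝ≥0∞)) atTop (𝓝 ⊤))
    (M : ℝ≥0)
    (hM : ⨅ γ ∈ {γ : T.Policy | ∀ i, ∫⁻ y, (φ i ((γ i).1 y) : ℝ≥0∞) ∂(R.Q i) ≤ M}, T.J γ =
      ⨅ γ : T.Policy, T.J γ) :
    ∃ γ : T.Policy, T.IsOptimal γ ∧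
      ∀ (κ : ∀ i, Kernel (Y i) (U i)) (_ : ∀ i, IsMarkovKernel (κ i))
        (μ : Measure (Ω₀ × (∀ i, Y i) × (∀ i, U i))),
        T.IsStrategicMeasure κ μ → T.J γ ≤ ∫⁻ s, (T.c s : ℝ≥0∞) ∂μ := by
  -- The measurement spaces come with a σ-algebra only; a Polish topology generating it is chosen to
  -- make weak convergence available.
  choose τ hτB hτP using fun i => StandardBorelSpace.polish (α := Y i)
  obtain ⟨γ, hγ⟩ := SequentialTeam.exists_forall_J_le R hlsc hKc hφK M
  have hopt : T.IsOptimal γ :=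
    le_antisymm (hM ▸ le_iInf₂ fun γ' hγ' => hγ γ' hγ') (iInf_le _ γ)
  refine ⟨γ, hopt, fun κ _ μ hμ => ?_⟩
  rw [hμ.lintegral_cost R]
  obtain ⟨γ', hγ'⟩ := SequentialTeam.exists_J_le_lintegral_meanCost R κ
  exact (hopt.trans_le (iInf_le _ γ')).trans hγ'
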